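/- Let $\mathbb{X}$ be a semi-abelian category, that is, a pointed, Barr exact and Bourn protomodular category with finite coproducts. Two morphisms $x\colon X\to D$ and $y\colon Y\to D$ of a pointed category with binary products \emph{Huq-commute} when there is a morphism $\varphi\colon X\times Y\to D$ with $\varphi\circ\langle 1_X,0\rangle=x$ and $\varphi\circ\langle 0,1_Y\rangle=y$. For an object $B$ of $\mathbb{X}$, let $\mathsf{Pt}_B(\mathbb{X})$ be the (pointed) category of points over $B$: its objects are the split epimorphisms with codomain $B$ together with a chosen section, and its morphisms are the morphisms over $B$ compatible with the sections. We say that $\mathbb{X}$ satisfies (SSH) when for every morphism $p\colon E\to B$ in $\mathbb{X}$ the pullback functor $p^{*}\colon\mathsf{Pt}_B(\mathbb{X})\to\mathsf{Pt}_E(\mathbb{X})$ reflects Huq-commutation: for any two morphisms $\alpha$, $\gamma$ in $\mathsf{Pt}_B(\mathbb{X})$ with the same codomain, if $p^{*}(\alpha)$ and $p^{*}(\gamma)$ Huq-commute, then so do $\alpha$ and $\gamma$. A \emph{weighted cospan} $(x,y,w)$ in $\mathbb{X}$ consists of morphisms $x\colon X\to D$, $y\colon Y\to D$ and $w\colon W\to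 D$. Write $\iota_W$ for the coproduct inclusions $W\to W+X$ and $W\to W+Y$, and $[u,v]$ for the morphism on a coproduct induced by $u$ and $v$. The morphisms $x$ and $y$ \emph{commute over} $w$ when there is a morphism $\varphi\colon (W+X)\times_W(W+Y)\to D$, where the pullback is that of $[1_W,0]\colon W+X\to W$ and $[1_W,0]\colon W+Y\to W$, such that $\varphi\circ\langle 1_{W+X},\iota_W\circ[1_W,0]\rangle=[w,x]$ and $\varphi\circ\langle\iota_W\circ[1_W,0],1_{W+Y}\rangle=[w,y]$. For subobjects $K$, $L$, $M$ of $D$, the \emph{Higgins commutator} $[K,L]\leq D$ is the image of the composite $\mathrm{Ker}(K+L\to K\times L)\to K+L\to D$, and the \emph{ternary Higgins commutator} $[K,L,M]\leq D$ is the image of the composite $\mathrm{Ker}\bigl(K+L+M\to(K+L)\times(K+M)\times(L+M)\bigr)\to K+L+M\to D$. Here the morphisms to $D$ are induced by the inclusions of the subobjects, and the other morphisms on the coproducts are the canonical ones: each component sends a summand that occurs in its codomain by the inclusion and the other summand to $0$. Given $w\colon W\to D$, the cospan $(x,y)$ is \emph{$w$-proper} when $[\mathrm{Im}(w),\mathrm{Im}(x)]\leq\mathrm{Im}(x)$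 and $[\mathrm{Im}(w),\mathrm{Im}(y)]\leq\mathrm{Im}(y)$. The following conditions are equivalent: \begin{enumerate} \item[(i)] $\mathbb{X}$ satisfies (SSH); \item[(ii)] for any weighted cospan $(x,y,w)$ such that $(x,y)$ is $w$-proper, if $x$ and $y$ Huq-commute, then they commute over $w$; \item[(iii)] for any cospan $(x,y)$, the property of commuting over $w$ is independent of the chosen weight $w$ for which $(x,y)$ is $w$-proper: if $(x,y)$ is both $w$-proper and $w'$-proper, for weights $w\colon W\to D$ and $w'\colon W'\to D$, then $x$ and $y$ commute over $w$ if and only if they commute over $w'$; \item[(iv)] for any weighted cospan $(x,y,w)$ such that $(x,y)$ is $w$-proper, if $[\mathrm{Im}(x),\mathrm{Im}(y)]=0$, then $[\mathrm{Im}(x),\mathrm{Im}(y),\mathrm{Im}(w)]=0$. \end{enumerate} -/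

import Mathlib

open CategoryTheory CategoryTheory.Limits

universe v u

-- morphisms `X ⟶ Y` are to be read through `CategoryStruct.toQuiver`
attribute [-instance] catToReflQuiver

noncomputable section

namespace SemiAb

variable {C : Type u} [Category.{v} C]

/-! ### The category of points over an object -/

/-- A point over `B`: a split epimorphism `π : obj ⟶ B` with a chosen section `σ`. -/
structure Point (B : C) where
  obj : C
  π : obj ⟶ B
  σ : B ⟶ obj
  σ_π : σ ≫ π = 𝟙 B

namespace Point

attribute [simp] σ_π

variable {B : C}

/-- A morphism of points over `B`: compatible with the split epimorphisms and the sections. -/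
@[ext]
structure Hom (P Q : Point B) where
  hom : P.obj ⟶ Q.obj
  hom_π : hom ≫ Q.π = P.π
  σ_hom : P.σ ≫ hom = Q.σ

attribute [simp] Hom.hom_π Hom.σ_hom

/-- The category `Pt_B(C)` of points over `B`. -/
instance : Category (Point B) where
  Hom P Q := Hom P Q
  id P := ⟨𝟙 P.obj, by simp, by simp⟩
  comp f g := ⟨f.hom ≫ g.hom, by simp, by simp [← Category.assoc]⟩

@[simp] lemma id_hom (P : Point B) : Hom.hom (𝟙 P) = 𝟙 P.obj := rfl

@[simp] lemma comp_hom {P Q R : Point B} (f : P ⟶ Q) (g : Q ⟶ R) :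
    (f ≫ g).hom = f.hom ≫ g.hom := rfl

@[ext] lemma hom_ext {P Q : Point B} {f g : P ⟶ Q} (h : f.hom = g.hom) : f = g :=
  Hom.ext h

/-- `Pt_B(C)` is pointed, the zero object being `(B, 1_B, 1_B)`; the zero morphism
`P ⟶ Q` is `σ_Q ∘ π_P`. -/
instance : HasZeroMorphisms (Point B) where
  zero P Q := ⟨⟨P.π ≫ Q.σ, by simp, by simp [← Category.assoc]⟩⟩
  comp_zero {P Q} f R := by
    apply Hom.ext
    change f.hom ≫ Q.π ≫ R.σ = P.π ≫ R.σ
    simp [← Category.assoc]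
  zero_comp P {Q R} f := by
    apply Hom.ext
    change (P.π ≫ Q.σ) ≫ f.hom = P.π ≫ R.σ
    simp

@[simp] lemma zero_hom (P Q : Point B) : (0 : P ⟶ Q).hom = P.π ≫ Q.σ := rfl

instance : HasZeroObject (Point B) where
  zero := ⟨⟨B, 𝟙 B, 𝟙 B, by simp⟩, by
    rw [IsZero.iff_id_eq_zero]
    ext
    simp⟩

section Pullbacks

variable [HasPullbacks C]

/-- The product of two points over `B`, carried by the fibre product over `B`. -/
def prodPoint (P Q : Point B) : Point B where
  obj := pullback P.π Q.π
  π := pullback.fst P.π Q.π ≫ P.π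
  σ := pullback.lift P.σ Q.σ (by simp)
  σ_π := by simp [pullback.lift_fst_assoc]

/-- The product cone of two points over `B`. -/
def prodFan (P Q : Point B) : BinaryFan P Q :=
  BinaryFan.mk (P := prodPoint P Q)
    (⟨pullback.fst P.π Q.π, rfl, pullback.lift_fst _ _ _⟩ : Hom (prodPoint P Q) P)
    (⟨pullback.snd P.π Q.π, pullback.condition.symm, pullback.lift_snd _ _ _⟩ :
      Hom (prodPoint P Q) Q)

/-- The fibre product over `B` is the product in `Pt_B(C)`. -/
def prodFanIsLimit (P Q : Point B) : IsLimit (prodFan P Q) :=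
  BinaryFan.IsLimit.mk _
    (fun {T} f g =>
      (⟨pullback.lift f.hom g.hom (by simp), by simp [prodPoint, pullback.lift_fst_assoc], by
        apply pullback.hom_ext <;> simp [prodPoint, pullback.lift_fst, pullback.lift_snd]⟩ : Hom T (prodPoint P Q)))
    (fun f g => by
      apply Hom.ext
      exact pullback.lift_fst _ _ _)
    (fun f g => by
      apply Hom.ext
      exact pullback.lift_snd _ _ _)
    (fun f g m h₁ h₂ => by
      apply Hom.ext
      apply pullback.hom_ext
      · exact (congrArg Hom.hom h₁).trans (pullback.lift_fst _ _ _).symm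
      · exact (congrArg Hom.hom h₂).trans (pullback.lift_snd _ _ _).symm)

instance : HasBinaryProducts (Point B) :=
  have (P Q : Point B) : HasLimit (pair P Q) := ⟨⟨⟨prodFan P Q, prodFanIsLimit P Q⟩⟩⟩
  hasBinaryProducts_of_hasLimit_pair _

/-- The change of base functor `p^* : Pt_B(C) ⥤ Pt_E(C)` of the fibration of points, given by
pulling back along `p : E ⟶ B`. -/
def baseChange {E B : C} (p : E ⟶ B) : Point B ⥤ Point E where
  obj P :=
    { obj := pullback P.π p
      π := pullback.snd P.π p
      σ := pullback.lift (p ≫ P.σ) (𝟙 E) (by simp)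
      σ_π := pullback.lift_snd _ _ _ }
  map {P Q} f :=
    { hom := pullback.lift (pullback.fst P.π p ≫ f.hom) (pullback.snd P.π p)
        (by simp [pullback.condition])
      hom_π := pullback.lift_snd _ _ _
      σ_hom := by
        apply pullback.hom_ext <;>
          simp [pullback.lift_fst, pullback.lift_snd, pullback.lift_fst_assoc] }
  map_id P := by
    apply Hom.ext
    apply pullback.hom_ext <;> simp
  map_comp f g := by
    apply Hom.ext
    apply pullback.hom_ext <;>
      simp [pullback.lift_fst, pullback.lift_snd, pullback.lift_fst_assoc]

end Pullbacks

end Point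

/-! ### Semi-abelian categories -/

/-- A semi-abelian category: pointed, Barr exact, Bourn protomodular, with finite coproducts. -/
class SemiAbelian (C : Type u) [Category.{v} C] : Prop
    extends Regular C, HasZeroObject C where
  hasFiniteCoproducts : HasFiniteCoproducts C
  /-- Barr exactness: every internal equivalence relation is a kernel pair. -/
  exact : ∀ {R A : C} (p₁ p₂ : R ⟶ A), IsEquivalenceRelation p₁ p₂ →
    ∃ (Q : C) (q : A ⟶ Q), IsKernelPair q p₁ p₂
  /-- Bourn protomodularity: the change of base functors of the fibration of points reflect
  isomorphisms. -/
  protomodular : ∀ {E B : C} (p : E ⟶ B), (Point.baseChange p).ReflectsIsomorphisms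

attribute [instance] SemiAbelian.hasFiniteCoproducts

/-! ### Commutation -/

/-- The morphisms `x` and `y` Huq-commute: there is `φ : X ⨯ Y ⟶ D` with `φ ∘ ⟨1, 0⟩ = x` and
`φ ∘ ⟨0, 1⟩ = y`. -/
def HuqCommute {C : Type u} [Category.{v} C] [HasZeroMorphisms C] [HasBinaryProducts C]
    {X Y D : C} (x : X ⟶ D) (y : Y ⟶ D) : Prop :=
  ∃ φ : X ⨯ Y ⟶ D, prod.lift (𝟙 X) 0 ≫ φ = x ∧ prod.lift 0 (𝟙 Y) ≫ φ = y

/-- Condition (SSH): every change of base functor of the fibration of points reflects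
Huq-commutation of arbitrary cospans. -/
def SSH (C : Type u) [Category.{v} C] [HasPullbacks C] : Prop :=
  ∀ {E B : C} (p : E ⟶ B) {P Q R : Point B} (α : P ⟶ R) (γ : Q ⟶ R),
    HuqCommute ((Point.baseChange p).map α) ((Point.baseChange p).map γ) → HuqCommute α γ

/-- For points `P = (A, f, r)` and `Q = (C, g, s)` over `B` and morphisms `α : A ⟶ D`,
`γ : C ⟶ D`, admissibility of `(α, β, γ)` with respect to `(f, r, g, s)`, where
`β = α ∘ r = γ ∘ s`: there is `φ : A ×_B C ⟶ D` with `φ ∘ ⟨1, s ∘ f⟩ = α` and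
`φ ∘ ⟨r ∘ g, 1⟩ = γ`. -/
def Admissible [HasPullbacks C] {B D : C} (P Q : Point B) (α : P.obj ⟶ D) (γ : Q.obj ⟶ D) :
    Prop :=
  ∃ φ : pullback P.π Q.π ⟶ D,
    pullback.lift (𝟙 P.obj) (P.π ≫ Q.σ) (by simp) ≫ φ = α ∧
    pullback.lift (Q.π ≫ P.σ) (𝟙 Q.obj) (by simp) ≫ φ = γ

/-- The point `[1, 0] : W ⨿ X ⟶ W` with section the coproduct inclusion. -/
def coprodPoint [HasZeroMorphisms C] [HasBinaryCoproducts C] (W X : C) : Point W where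
  obj := W ⨿ X
  π := coprod.desc (𝟙 W) 0
  σ := coprod.inl
  σ_π := coprod.inl_desc _ _

/-- For a weighted cospan `(x, y, w)`: the morphisms `x` and `y` commute over `w`. -/
def CommuteOver [HasZeroMorphisms C] [HasBinaryCoproducts C] [HasPullbacks C]
    {X Y W D : C} (x : X ⟶ D) (y : Y ⟶ D) (w : W ⟶ D) : Prop :=
  Admissible (coprodPoint W X) (coprodPoint W Y) (coprod.desc w x) (coprod.desc w y)

/-! ### Higgins commutators -/

section Higgins

variable [HasZeroMorphisms C] [SemiAbelian C]

/-- The canonical morphism `K + L ⟶ K × L`. -/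
def binaryComparison (K L : C) : K ⨿ L ⟶ K ⨯ L :=
  coprod.desc (prod.lift (𝟙 K) 0) (prod.lift 0 (𝟙 L))

/-- The canonical morphism `K + L + M ⟶ (K + L) × (K + M) × (L + M)`. -/
def ternaryComparison (K L M : C) :
    (K ⨿ L) ⨿ M ⟶ ((K ⨿ L) ⨯ (K ⨿ M)) ⨯ (L ⨿ M) :=
  coprod.desc
    (coprod.desc
      (prod.lift (prod.lift coprod.inl coprod.inl) 0)
      (prod.lift (prod.lift coprod.inr 0) coprod.inl))
    (prod.lift (prod.lift 0 coprod.inr) coprod.inr)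

/-- The binary Higgins commutator `[K, L] ≤ D`: the image of the co-smash product `K ⋄ L`. -/
def higgins {D : C} (K L : Subobject D) : Subobject D :=
  imageSubobject
    (kernel.ι (binaryComparison (K : C) (L : C)) ≫ coprod.desc K.arrow L.arrow)

/-- The ternary Higgins commutator `[K, L, M] ≤ D`: the image of the co-smash product
`K ⋄ L ⋄ M`. -/
def higgins₃ {D : C} (K L M : Subobject D) : Subobject D :=
  imageSubobject
    (kernel.ι (ternaryComparison (K : C) (L : C) (M : C)) ≫
      coprod.desc (coprod.desc K.arrow L.arrow) M.arrow)

/-- The subobject `X` of `D` is `w`-normal: `[Im w, X] ≤ X`. -/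
def WNormal {W D : C} (w : W ⟶ D) (X : Subobject D) : Prop :=
  higgins (imageSubobject w) X ≤ X

/-- The cospan `(x, y)` is `w`-proper: the images of `x` and `y` are `w`-normal. -/
def WProper {X Y W D : C} (x : X ⟶ D) (y : Y ⟶ D) (w : W ⟶ D) : Prop :=
  WNormal w (imageSubobject x) ∧ WNormal w (imageSubobject y)

end Higgins

end SemiAb

end

namespace SemiAb

variable {C : Type u} [Category.{v} C] [HasZeroMorphisms C] [SemiAbelian C]

open ZeroObject

set_option linter.unusedSectionVars false

attribute [simp] prod.lift_fst prod.lift_snd prod.lift_fst_assoc prod.lift_snd_assoc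
  pullback.lift_fst pullback.lift_snd pullback.lift_fst_assoc pullback.lift_snd_assoc
  coprod.inl_desc coprod.inr_desc coprod.inl_desc_assoc coprod.inr_desc_assoc

/-! By protomodularity, the kernel and the section of a split epimorphism are jointly extremal
epimorphic. Hence regular epimorphisms are cokernels of their kernels, and a morphism descends along
a quotient as soon as it kills the kernel. Both commutation conditions become such descent problems.

(i) ⇒ (ii): `[w, x]` and `[w, y]` become morphisms of points over `W` into `W ⨯ D` with section `⟨1,
w⟩`. Base change along `0 ⟶ W` restricts them to kernels. Properness puts the values of these
restrictions in `Im x` and `Im y`, which Huq-commute, and (SSH) lifts this commutation back to the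
points.

(ii) ⇒ (i): if base changes commute, so do the restrictions to kernels. These are proper for the
section of the codomain, hence commute over it by (ii), and `admissible_of_commuteOver` passes from
there to the points themselves.

(ii) ⇔ (iii): every cospan is proper for the weight `0 ⟶ D`, and commuting over it is Huq-commuting.

(ii) ⇔ (iv): by `commuteOver_iff`, the obstruction to commuting over a weight splits into the binary
and the ternary co-smash product. -/

lemma comp_eq_assoc {A : Type*} [Category A] {X Y Z W : A} {f : X ⟶ Y} {g : Y ⟶ Z} {k : X ⟶ Z}
    (h : f ≫ g = k) (z : Z ⟶ W) : f ≫ g ≫ z = k ≫ z := by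
  rw [← Category.assoc, h]

@[simp]
lemma Point.σ_π_assoc {A : Type*} [Category A] {B D : A} (P : Point B) (z : B ⟶ D) :
    P.σ ≫ P.π ≫ z = z := by
  rw [comp_eq_assoc P.σ_π, Category.id_comp]

@[simp]
lemma Point.hom_π_assoc {A : Type*} [Category A] {B D : A} {P Q : Point B} (f : P ⟶ Q)
    (z : B ⟶ D) : f.hom ≫ Q.π ≫ z = P.π ≫ z :=
  comp_eq_assoc f.hom_π z

@[simp]
lemma Point.σ_hom_assoc {A : Type*} [Category A] {B D : A} {P Q : Point B} (f : P ⟶ Q)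
    (z : Q.obj ⟶ D) : P.σ ≫ f.hom ≫ z = Q.σ ≫ z :=
  comp_eq_assoc f.σ_hom z

/-! ### Split epimorphisms and regular epimorphisms -/

/-- In a split extension, a subobject containing the kernel and the section is everything. -/
lemma isIso_of_section_of_kernel {A B S : C} {f : A ⟶ B} {r : B ⟶ A} (h : r ≫ f = 𝟙 B)
    (m : S ⟶ A) [Mono m] (hr : ∃ r', r' ≫ m = r)
    (hk : ∀ ⦃T : C⦄ (t : T ⟶ A), t ≫ f = 0 → ∃ t', t' ≫ m = t) : IsIso m := by
  obtain ⟨r', hr⟩ := hr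
  let P : Point B := ⟨S, m ≫ f, r', by rw [← Category.assoc, hr, h]⟩
  let Q : Point B := ⟨A, f, r, h⟩
  let μ : P ⟶ Q := (⟨m, rfl, hr⟩ : Point.Hom P Q)
  -- Base change along `0 ⟶ B` takes kernels. It turns `m` into an isomorphism, and protomodularity
  -- reflects this.
  let p : (0 : C) ⟶ B := 0
  have hz : pullback.fst f p ≫ f = 0 := by rw [pullback.condition]; simp [p]
  obtain ⟨k, hk⟩ := hk _ hz
  let ν : pullback f p ⟶ pullback (m ≫ f) p :=
    pullback.lift k (pullback.snd f p) (by
      rw [← Category.assoc, hk, pullback.condition])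
  have hν₁ : ν ≫ ((Point.baseChange p).map μ).hom = 𝟙 (pullback f p) := by
    apply pullback.hom_ext
    · simp [ν, Point.baseChange, μ, P, Q, hk]
    · simp [ν, Point.baseChange, μ, P, Q]
  have hν₂ : ((Point.baseChange p).map μ).hom ≫ ν = 𝟙 (pullback (m ≫ f) p) := by
    apply pullback.hom_ext
    · rw [← cancel_mono m]
      simp [ν, Point.baseChange, μ, P, Q, hk]
    · simp [ν, Point.baseChange, μ, P, Q]
  have hσ : ((Point.baseChange p).obj Q).σ ≫ ν = ((Point.baseChange p).obj P).σ := by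
    rw [← ((Point.baseChange p).map μ).σ_hom]
    exact (Category.assoc _ _ _).trans ((congrArg _ hν₂).trans (Category.comp_id _))
  let ν' : (Point.baseChange p).obj Q ⟶ (Point.baseChange p).obj P :=
    (⟨ν, pullback.lift_snd _ _ _, hσ⟩ : Point.Hom _ _)
  have : IsIso ((Point.baseChange p).map μ) :=
    ⟨ν', Point.hom_ext hν₂, Point.hom_ext hν₁⟩
  have := SemiAbelian.protomodular p
  have : IsIso μ := isIso_of_reflects_iso μ (Point.baseChange p)
  exact ⟨(inv μ).hom, congrArg Point.Hom.hom (IsIso.hom_inv_id μ),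
    congrArg Point.Hom.hom (IsIso.inv_hom_id μ)⟩

/-- In a split extension, the kernel and the section are jointly epimorphic. -/
lemma hom_ext_of_section_of_kernel {A B D : C} {f : A ⟶ B} {r : B ⟶ A} (h : r ≫ f = 𝟙 B)
    {u v : A ⟶ D} (hr : r ≫ u = r ≫ v)
    (hk : ∀ ⦃T : C⦄ (t : T ⟶ A), t ≫ f = 0 → t ≫ u = t ≫ v) : u = v := by
  have : IsIso (equalizer.ι u v) := isIso_of_section_of_kernel h _ ⟨equalizer.lift r hr, by simp⟩
    fun T t ht => ⟨equalizer.lift t (hk t ht), by simp⟩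
  rw [← cancel_epi (equalizer.ι u v), equalizer.condition]

/-- Extremality already implies epi, since equalizers exist; in a regular category an extremal
epimorphism is regular. -/
lemma isRegularEpi_of_forall_mono {X Y : C} (f : X ⟶ Y)
    (hf : ∀ ⦃Z : C⦄ (p : X ⟶ Z) (i : Z ⟶ Y) (_ : p ≫ i = f) [Mono i], IsIso i) :
    IsRegularEpi f := by
  have := ExtremalEpi.mk_of_hasEqualizers f hf
  infer_instance

instance {X Y : C} (f : X ⟶ Y) : IsRegularEpi (factorThruImageSubobject f) := by
  have : StrongEpi (factorThruImageSubobject f) := by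
    unfold factorThruImageSubobject
    infer_instance
  infer_instance

/-- A regular epimorphism is the cokernel of its kernel. -/
lemma exists_fac_of_kernel {A Q D : C} (q : A ⟶ Q) [IsRegularEpi q] (d : A ⟶ D)
    (hd : kernel.ι q ≫ d = 0) : ∃ φ, q ≫ φ = d := by
  apply IsRegularEpi.exists_of_isKernelPair q (IsKernelPair.of_hasPullback q) d
  -- The kernel pair is split by the diagonal, and the kernel of its first projection is the kernel
  -- of `q`. It suffices to compare the two projections followed by `d` on these two parts.
  apply hom_ext_of_section_of_kernel (f := pullback.fst q q)
    (r := pullback.lift (𝟙 A) (𝟙 A) rfl) (by simp)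
  · simp
  · intro T t ht
    have hs : (t ≫ pullback.snd q q) ≫ q = 0 := by
      rw [Category.assoc, ← pullback.condition, comp_eq_assoc ht, zero_comp]
    rw [comp_eq_assoc ht, zero_comp, ← Category.assoc, ← kernel.lift_ι q _ hs, Category.assoc, hd,
      comp_zero]

lemma exists_fac_iff {A Q D : C} (q : A ⟶ Q) [IsRegularEpi q] (d : A ⟶ D) :
    (∃ φ, q ≫ φ = d) ↔ kernel.ι q ≫ d = 0 :=
  ⟨by rintro ⟨φ, rfl⟩; simp, exists_fac_of_kernel q d⟩

/-! ### Products of points -/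

/-- A product of two points over `B`, presented by an arbitrary fibre product over `B`. -/
structure PointProduct {B : C} (P Q : Point B) where
  obj : C
  fst : obj ⟶ P.obj
  snd : obj ⟶ Q.obj
  isPullback : IsPullback fst snd P.π Q.π
  inl : P.obj ⟶ obj
  inr : Q.obj ⟶ obj
  inl_fst : inl ≫ fst = 𝟙 P.obj
  inl_snd : inl ≫ snd = P.π ≫ Q.σ
  inr_fst : inr ≫ fst = Q.π ≫ P.σ
  inr_snd : inr ≫ snd = 𝟙 Q.obj

namespace PointProduct

attribute [simp] inl_fst inl_snd inr_fst inr_snd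

/-- The product given by the chosen pullback. -/
@[reducible]
noncomputable def ofPullback {B : C} (P Q : Point B) : PointProduct P Q where
  obj := pullback P.π Q.π
  fst := pullback.fst _ _
  snd := pullback.snd _ _
  isPullback := .of_hasPullback _ _
  inl := pullback.lift (𝟙 P.obj) (P.π ≫ Q.σ) (by simp)
  inr := pullback.lift (Q.π ≫ P.σ) (𝟙 Q.obj) (by simp)
  inl_fst := by simp
  inl_snd := by simp
  inr_fst := by simp
  inr_snd := by simp

/-- An object, viewed as a point over the zero object. -/
@[reducible]
noncomputable def zeroPoint (X : C) : Point (0 : C) where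
  obj := X
  π := 0
  σ := 0
  σ_π := (isZero_zero C).eq_of_src _ _

/-- The binary product, as a product of points over the zero object. -/
@[reducible]
noncomputable def ofProd (X Y : C) : PointProduct (zeroPoint X) (zeroPoint Y) where
  obj := X ⨯ Y
  fst := prod.fst
  snd := prod.snd
  isPullback := by
    convert! IsPullback.of_is_product (prodIsProd X Y) (isZero_zero C).isTerminal <;>
      exact (isZero_zero C).eq_of_tgt _ _
  inl := prod.lift (𝟙 X) 0
  inr := prod.lift 0 (𝟙 Y)
  inl_fst := by simp
  inl_snd := by simp
  inr_fst := by simp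
  inr_snd := by simp

variable {B : C} {P Q : Point B} (T : PointProduct P Q)

@[simp]
lemma inl_fst_assoc {D : C} (z : P.obj ⟶ D) : T.inl ≫ T.fst ≫ z = z := by
  rw [comp_eq_assoc T.inl_fst, Category.id_comp]

@[simp]
lemma inl_snd_assoc {D : C} (z : Q.obj ⟶ D) : T.inl ≫ T.snd ≫ z = P.π ≫ Q.σ ≫ z := by
  rw [comp_eq_assoc T.inl_snd, Category.assoc]

@[simp]
lemma inr_fst_assoc {D : C} (z : P.obj ⟶ D) : T.inr ≫ T.fst ≫ z = Q.π ≫ P.σ ≫ z := by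
  rw [comp_eq_assoc T.inr_fst, Category.assoc]

@[simp]
lemma inr_snd_assoc {D : C} (z : Q.obj ⟶ D) : T.inr ≫ T.snd ≫ z = z := by
  rw [comp_eq_assoc T.inr_snd, Category.id_comp]

/-- The kernel of `T.snd` is carried by `T.inl`. As `T.inr` is a section of `T.snd`, this turns
joint statements about kernel and section into statements about the two inclusions. -/
lemma eq_comp_inl {Z : C} (t : Z ⟶ T.obj) (ht : t ≫ T.snd = 0) : t = (t ≫ T.fst) ≫ T.inl := by
  apply T.isPullback.hom_ext
  · simp
  · rw [ht, Category.assoc, T.inl_snd, Category.assoc, comp_eq_assoc T.isPullback.w, Category.assoc, comp_eq_assoc ht,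
      zero_comp]

lemma σ_inl : P.σ ≫ T.inl = Q.σ ≫ T.inr := by
  apply T.isPullback.hom_ext <;> simp

/-- The inclusions into a product of points are jointly extremal epimorphic. -/
lemma isIso_of_mono {S : C} (m : S ⟶ T.obj) [Mono m] (hl : ∃ l, l ≫ m = T.inl)
    (hr : ∃ r, r ≫ m = T.inr) : IsIso m := by
  obtain ⟨l, hl⟩ := hl
  refine isIso_of_section_of_kernel T.inr_snd m hr fun Z t ht => ⟨t ≫ T.fst ≫ l, ?_⟩
  rw [T.eq_comp_inl t ht]
  simp [hl]

lemma hom_ext {D : C} {u v : T.obj ⟶ D} (hl : T.inl ≫ u = T.inl ≫ v)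
    (hr : T.inr ≫ u = T.inr ≫ v) : u = v := by
  refine hom_ext_of_section_of_kernel T.inr_snd hr fun Z t ht => ?_
  rw [T.eq_comp_inl t ht]
  simp [hl]

/-- A morphism on a product of points compatible with quotients of both factors descends. -/
lemma exists_desc {P' Q' : Point B} (T' : PointProduct P' Q') (e : P ⟶ P') (e' : Q ⟶ Q')
    [IsRegularEpi e.hom] [IsRegularEpi e'.hom] {D : C} {α : P'.obj ⟶ D} {γ : Q'.obj ⟶ D}
    (φ : T.obj ⟶ D) (hl : T.inl ≫ φ = e.hom ≫ α) (hr : T.inr ≫ φ = e'.hom ≫ γ) :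
    ∃ φ' : T'.obj ⟶ D, T'.inl ≫ φ' = α ∧ T'.inr ≫ φ' = γ := by
  let q : T.obj ⟶ T'.obj := T'.isPullback.lift (T.fst ≫ e.hom) (T.snd ≫ e'.hom)
    (by simp [T.isPullback.w])
  have hq₁ : q ≫ T'.fst = T.fst ≫ e.hom := T'.isPullback.lift_fst _ _ _
  have hq₂ : q ≫ T'.snd = T.snd ≫ e'.hom := T'.isPullback.lift_snd _ _ _
  have hql : T.inl ≫ q = e.hom ≫ T'.inl := by
    apply T'.isPullback.hom_ext
    · simp [hq₁]
    · simp [hq₂]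
  have hqr : T.inr ≫ q = e'.hom ≫ T'.inr := by
    apply T'.isPullback.hom_ext
    · simp [hq₁]
    · simp [hq₂]
  have : IsRegularEpi q := by
    apply isRegularEpi_of_forall_mono
    intro Z p i hp _
    apply T'.isIso_of_mono
    -- The regular epimorphism `e.hom` is left orthogonal to the mono `i`, so `T'.inl` factors
    -- through `i`.
    · have sq : CommSq (T.inl ≫ p) e.hom i T'.inl := ⟨by rw [Category.assoc, hp, hql]⟩
      exact ⟨sq.lift, sq.fac_right⟩
    · have sq : CommSq (T.inr ≫ p) e'.hom i T'.inr := ⟨by rw [Category.assoc, hp, hqr]⟩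
      exact ⟨sq.lift, sq.fac_right⟩
  let k := kernel.ι e.hom
  let l := kernel.ι e'.hom
  have hk : k ≫ P.π = 0 := by rw [← e.hom_π, kernel.condition_assoc, zero_comp]
  have hl' : l ≫ Q.π = 0 := by rw [← e'.hom_π, kernel.condition_assoc, zero_comp]
  -- Both kernels lie over zero in `B`, so their plain product maps to the fibre product, and it
  -- covers the kernel of `q`. That `φ` vanishes there can be tested on the two axes.
  let ψ : kernel e.hom ⨯ kernel e'.hom ⟶ T.obj :=
    T.isPullback.lift (prod.fst ≫ k) (prod.snd ≫ l) (by simp [hk, hl'])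
  have hψ₁ : ψ ≫ T.fst = prod.fst ≫ k := T.isPullback.lift_fst _ _ _
  have hψ₂ : ψ ≫ T.snd = prod.snd ≫ l := T.isPullback.lift_snd _ _ _
  have hψ : ψ ≫ φ = 0 := by
    have h₁ : prod.lift (𝟙 (kernel e.hom)) (0 : _ ⟶ kernel e'.hom) ≫ ψ = k ≫ T.inl := by
      apply T.isPullback.hom_ext
      · simp [hψ₁]
      · simp [hψ₂, comp_eq_assoc hk]
    have h₂ : prod.lift (0 : _ ⟶ kernel e.hom) (𝟙 (kernel e'.hom)) ≫ ψ = l ≫ T.inr := by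
      apply T.isPullback.hom_ext
      · simp [hψ₁, comp_eq_assoc hl']
      · simp [hψ₂]
    apply (ofProd (kernel e.hom) (kernel e'.hom)).hom_ext
    · change prod.lift (𝟙 _) 0 ≫ ψ ≫ φ = prod.lift (𝟙 _) 0 ≫ 0
      simp [comp_eq_assoc h₁, hl, k]
    · change prod.lift 0 (𝟙 _) ≫ ψ ≫ φ = prod.lift 0 (𝟙 _) ≫ 0
      simp [comp_eq_assoc h₂, hr, l]
  obtain ⟨φ', hφ'⟩ := exists_fac_of_kernel q φ (by
    have h₁ : (kernel.ι q ≫ T.fst) ≫ e.hom = 0 := by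
      rw [Category.assoc, ← hq₁, kernel.condition_assoc, zero_comp]
    have h₂ : (kernel.ι q ≫ T.snd) ≫ e'.hom = 0 := by
      rw [Category.assoc, ← hq₂, kernel.condition_assoc, zero_comp]
    have : kernel.ι q = prod.lift (kernel.lift _ _ h₁) (kernel.lift _ _ h₂) ≫ ψ := by
      apply T.isPullback.hom_ext
      · simp [hψ₁, k]
      · simp [hψ₂, l]
    rw [this, Category.assoc, hψ, comp_zero])
  refine ⟨φ', ?_, ?_⟩
  · rw [← cancel_epi e.hom, ← Category.assoc, ← hql, Category.assoc, hφ', hl]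
  · rw [← cancel_epi e'.hom, ← Category.assoc, ← hqr, Category.assoc, hφ', hr]

end PointProduct

open PointProduct

attribute [reducible] coprodPoint Point.prodPoint Point.prodFan Point.baseChange

/-! ### Commutation of morphisms of points -/

/-- Huq-commutation in the category of points is admissibility. -/
lemma huqCommute_point_iff {B : C} {P Q R : Point B} (α : P ⟶ R) (γ : Q ⟶ R) :
    HuqCommute α γ ↔ Admissible P Q α.hom γ.hom := by
  let i : P ⟶ Point.prodPoint P Q :=
    (⟨(ofPullback P Q).inl, by simp [Point.prodPoint], by
      apply pullback.hom_ext <;> simp [Point.prodPoint]⟩ : Point.Hom _ _)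
  let j : Q ⟶ Point.prodPoint P Q :=
    (⟨(ofPullback P Q).inr, by simp [Point.prodPoint], by
      apply pullback.hom_ext <;> simp [Point.prodPoint]⟩ : Point.Hom _ _)
  have hi₁ : i ≫ (Point.prodFan P Q).fst = 𝟙 P := Point.hom_ext (ofPullback P Q).inl_fst
  have hi₂ : i ≫ (Point.prodFan P Q).snd = 0 := Point.hom_ext (ofPullback P Q).inl_snd
  have hj₁ : j ≫ (Point.prodFan P Q).fst = 0 := Point.hom_ext (ofPullback P Q).inr_fst
  have hj₂ : j ≫ (Point.prodFan P Q).snd = 𝟙 Q := Point.hom_ext (ofPullback P Q).inr_snd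
  constructor
  · rintro ⟨φ, h₁, h₂⟩
    let ψ : Point.prodPoint P Q ⟶ P ⨯ Q :=
      prod.lift (Point.prodFan P Q).fst (Point.prodFan P Q).snd
    have hi : i ≫ ψ = prod.lift (𝟙 P) 0 := by
      apply Limits.prod.hom_ext
      · exact ((Category.assoc _ _ _).trans (congrArg _ (prod.lift_fst _ _))).trans
          (hi₁.trans (prod.lift_fst _ _).symm)
      · exact ((Category.assoc _ _ _).trans (congrArg _ (prod.lift_snd _ _))).trans
          (hi₂.trans (prod.lift_snd _ _).symm)
    have hj : j ≫ ψ = prod.lift 0 (𝟙 Q) := by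
      apply Limits.prod.hom_ext
      · exact ((Category.assoc _ _ _).trans (congrArg _ (prod.lift_fst _ _))).trans
          (hj₁.trans (prod.lift_fst _ _).symm)
      · exact ((Category.assoc _ _ _).trans (congrArg _ (prod.lift_snd _ _))).trans
          (hj₂.trans (prod.lift_snd _ _).symm)
    refine ⟨(ψ ≫ φ).hom, ?_, ?_⟩
    · exact congrArg Point.Hom.hom ((comp_eq_assoc hi φ).trans h₁)
    · exact congrArg Point.Hom.hom ((comp_eq_assoc hj φ).trans h₂)
  · rintro ⟨φ, h₁, h₂⟩
    -- Compatibility with the projections to `B` is automatic, because the two inclusions are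
    -- jointly epimorphic.
    let φ' : Point.prodPoint P Q ⟶ R := (⟨φ, by
      apply (ofPullback P Q).hom_ext
      · rw [comp_eq_assoc h₁]
        simp
      · rw [comp_eq_assoc h₂]
        simp, by
      rw [← i.σ_hom, Category.assoc]
      exact (congrArg _ h₁).trans α.σ_hom⟩ : Point.Hom _ _)
    let ψ : P ⨯ Q ⟶ Point.prodPoint P Q :=
      (Point.prodFanIsLimit P Q).lift (BinaryFan.mk prod.fst prod.snd)
    have hψ₁ : ψ ≫ (Point.prodFan P Q).fst = prod.fst :=
      (Point.prodFanIsLimit P Q).fac _ ⟨WalkingPair.left⟩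
    have hψ₂ : ψ ≫ (Point.prodFan P Q).snd = prod.snd :=
      (Point.prodFanIsLimit P Q).fac _ ⟨WalkingPair.right⟩
    have hi : prod.lift (𝟙 P) 0 ≫ ψ = i := by
      apply BinaryFan.IsLimit.hom_ext (Point.prodFanIsLimit P Q)
      · exact ((Category.assoc _ _ _).trans (congrArg _ hψ₁)).trans
          ((prod.lift_fst _ _).trans hi₁.symm)
      · exact ((Category.assoc _ _ _).trans (congrArg _ hψ₂)).trans
          ((prod.lift_snd _ _).trans hi₂.symm)
    have hj : prod.lift 0 (𝟙 Q) ≫ ψ = j := by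
      apply BinaryFan.IsLimit.hom_ext (Point.prodFanIsLimit P Q)
      · exact ((Category.assoc _ _ _).trans (congrArg _ hψ₁)).trans
          ((prod.lift_fst _ _).trans hj₁.symm)
      · exact ((Category.assoc _ _ _).trans (congrArg _ hψ₂)).trans
          ((prod.lift_snd _ _).trans hj₂.symm)
    refine ⟨ψ ≫ φ', ?_, ?_⟩
    · rw [comp_eq_assoc hi]
      exact Point.hom_ext h₁
    · rw [comp_eq_assoc hj]
      exact Point.hom_ext h₂

/-- If the restrictions to the kernels commute over the restriction to the base, then the
morphisms are admissible. -/
lemma admissible_of_commuteOver {B D : C} (P Q : Point B) (α : P.obj ⟶ D) (γ : Q.obj ⟶ D)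
    (hσ : P.σ ≫ α = Q.σ ≫ γ)
    (h : CommuteOver (kernel.ι P.π ≫ α) (kernel.ι Q.π ≫ γ) (P.σ ≫ α)) :
    Admissible P Q α γ := by
  -- Every point is a regular quotient of the coproduct point on its kernel, so commutation over the
  -- section can descend along these quotients.
  have key (P : Point B) : ∃ e : coprodPoint B (kernel P.π) ⟶ P,
      e.hom = coprod.desc P.σ (kernel.ι P.π) ∧ IsRegularEpi e.hom := by
    refine ⟨(⟨coprod.desc P.σ (kernel.ι P.π), ?_, ?_⟩ : Point.Hom _ _), rfl, ?_⟩
    · apply coprod.hom_ext <;> simp [coprodPoint]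
    · simp [coprodPoint]
    · apply isRegularEpi_of_forall_mono
      intro Z p i hp _
      refine isIso_of_section_of_kernel P.σ_π i ⟨coprod.inl ≫ p, ?_⟩ fun T t ht =>
        ⟨kernel.lift _ t ht ≫ coprod.inr ≫ p, ?_⟩
      · rw [Category.assoc, hp]
        exact coprod.inl_desc _ _
      · rw [Category.assoc, Category.assoc, hp]
        exact (congrArg _ (coprod.inr_desc _ _)).trans (kernel.lift_ι _ _ _)
  obtain ⟨e, he, _⟩ := key P
  obtain ⟨e', he', _⟩ := key Q
  obtain ⟨φ, h₁, h₂⟩ := h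
  refine (ofPullback _ _).exists_desc (ofPullback P Q) e e' φ (h₁.trans ?_) (h₂.trans ?_)
  · rw [he]
    apply coprod.hom_ext <;> simp
  · rw [he']
    apply coprod.hom_ext <;> simp [hσ]

/-- Huq-commuting morphisms have Huq-commuting images. -/
lemma HuqCommute.image {X Y D : C} {x : X ⟶ D} {y : Y ⟶ D} (h : HuqCommute x y) :
    HuqCommute (imageSubobject x).arrow (imageSubobject y).arrow := by
  obtain ⟨φ, h₁, h₂⟩ := h
  -- Seen over the zero object, the image factorizations are quotients of points, so `exists_desc`
  -- applies.
  let e {Z : C} (z : Z ⟶ D) : zeroPoint Z ⟶ zeroPoint (imageSubobject z : C) :=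
    (⟨factorThruImageSubobject z, (isZero_zero C).eq_of_tgt _ _,
      (isZero_zero C).eq_of_src _ _⟩ : Point.Hom _ _)
  have (Z : C) (z : Z ⟶ D) : IsRegularEpi (e z).hom :=
    inferInstanceAs (IsRegularEpi (factorThruImageSubobject z))
  exact (ofProd X Y).exists_desc (ofProd _ _) (e x) (e y) φ
    (h₁.trans (imageSubobject_arrow_comp x).symm) (h₂.trans (imageSubobject_arrow_comp y).symm)

/-- The summands `X` and `Y` lie in the kernels of the two coproduct points, so `X ⨯ Y` maps to the
fibre product over `W`. -/
lemma CommuteOver.huqCommute {X Y W D : C} {x : X ⟶ D} {y : Y ⟶ D} {w : W ⟶ D}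
    (h : CommuteOver x y w) : HuqCommute x y := by
  obtain ⟨φ, h₁, h₂⟩ := h
  let ψ : X ⨯ Y ⟶ pullback (coprodPoint W X).π (coprodPoint W Y).π :=
    pullback.lift (prod.fst ≫ coprod.inr) (prod.snd ≫ coprod.inr) (by simp [coprodPoint])
  have hl : prod.lift (𝟙 X) 0 ≫ ψ = coprod.inr (X := W) ≫
      (ofPullback (coprodPoint W X) (coprodPoint W Y)).inl := by
    apply pullback.hom_ext
    · simp [ψ, coprodPoint]
    · simp [ψ, coprodPoint]
  have hr : prod.lift 0 (𝟙 Y) ≫ ψ = coprod.inr (X := W) ≫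
      (ofPullback (coprodPoint W X) (coprodPoint W Y)).inr := by
    apply pullback.hom_ext
    · simp [ψ, coprodPoint]
    · simp [ψ, coprodPoint]
  refine ⟨ψ ≫ φ, ?_, ?_⟩
  · rw [comp_eq_assoc hl, Category.assoc]
    exact (congrArg _ h₁).trans (coprod.inr_desc _ _)
  · rw [comp_eq_assoc hr, Category.assoc]
    exact (congrArg _ h₂).trans (coprod.inr_desc _ _)

/-- Over the zero object `0 ⨿ X` collapses to `X`, and the fibre product maps to `X ⨯ Y`. -/
lemma HuqCommute.commuteOver_zero {X Y D : C} {x : X ⟶ D} {y : Y ⟶ D} (h : HuqCommute x y) :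
    CommuteOver x y (0 : (0 : C) ⟶ D) := by
  obtain ⟨φ, h₁, h₂⟩ := h
  refine ⟨prod.lift (pullback.fst _ _ ≫ coprod.desc 0 (𝟙 X))
    (pullback.snd _ _ ≫ coprod.desc 0 (𝟙 Y)) ≫ φ, ?_, ?_⟩
  · rw [← h₁, ← Category.assoc]
    apply coprod.hom_ext
    · exact (isZero_zero C).eq_of_src _ _
    · rw [coprod.inr_desc, ← Category.assoc]
      congr 1
      apply Limits.prod.hom_ext <;> simp [coprodPoint]
  · rw [← h₂, ← Category.assoc]
    apply coprod.hom_ext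
    · exact (isZero_zero C).eq_of_src _ _
    · rw [coprod.inr_desc, ← Category.assoc]
      congr 1
      apply Limits.prod.hom_ext <;> simp [coprodPoint]

/-! ### Normality with respect to a weight -/

lemma higgins_le_iff {D : C} (K L M : Subobject D) :
    higgins K L ≤ M ↔ ∃ g : kernel (binaryComparison (K : C) (L : C)) ⟶ (M : C),
      g ≫ M.arrow = kernel.ι _ ≫ coprod.desc K.arrow L.arrow := by
  rw [higgins]
  constructor
  · intro h
    refine ⟨factorThruImageSubobject _ ≫ Subobject.ofLE _ _ h, ?_⟩
    rw [Category.assoc, Subobject.ofLE_arrow]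
    exact imageSubobject_arrow_comp _
  · rintro ⟨g, hg⟩
    exact imageSubobject_le _ g hg

/-- If `Im x` is `w`-normal, then the action of `W` on `X` takes values in `Im x`. -/
lemma WNormal.exists_fac {X W D : C} {x : X ⟶ D} {w : W ⟶ D}
    (h : WNormal w (imageSubobject x)) {Z : C} (t : Z ⟶ W ⨿ X)
    (ht : t ≫ coprod.desc (𝟙 W) 0 = 0) :
    ∃ g, g ≫ (imageSubobject x).arrow = t ≫ coprod.desc w x := by
  obtain ⟨g, hg⟩ := (higgins_le_iff _ _ _).1 h
  let κ := kernel.ι (coprod.desc (𝟙 W) (0 : X ⟶ W))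
  let s : X ⟶ kernel (coprod.desc (𝟙 W) (0 : X ⟶ W)) := kernel.lift _ coprod.inr (by simp)
  have hs : s ≫ κ = coprod.inr := kernel.lift_ι _ _ _
  let ew := factorThruImageSubobject w
  let ex := factorThruImageSubobject x
  have hd : coprod.desc w x = coprod.map ew ex ≫
      coprod.desc (imageSubobject w).arrow (imageSubobject x).arrow := by
    apply coprod.hom_ext <;> simp [ew, ex]
  -- The kernel of `[1, 0]` is itself split over `X` by `[0, 1]`, with kernel the co-smash product
  -- of `W` and `X`. The section lands in `Im x` through `ex`, the co-smash product by
  -- `w`-normality; hence so does everything.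
  have : IsIso (pullback.snd (imageSubobject x).arrow (κ ≫ coprod.desc w x)) := by
    refine isIso_of_section_of_kernel (f := κ ≫ coprod.desc 0 (𝟙 X)) (r := s) ?_ _
      ⟨pullback.lift ex s ?_, pullback.lift_snd _ _ _⟩ fun T t ht => ?_
    · simp [comp_eq_assoc hs]
    · simp [comp_eq_assoc hs, ex]
    · have h₀ : (t ≫ κ ≫ coprod.map ew ex) ≫ binaryComparison _ _ = 0 := by
        have h₁ : coprod.map ew ex ≫ binaryComparison _ _ ≫ prod.fst =
            coprod.desc (𝟙 W) 0 ≫ ew := by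
          apply coprod.hom_ext <;> simp [binaryComparison]
        have h₂ : coprod.map ew ex ≫ binaryComparison _ _ ≫ prod.snd =
            coprod.desc 0 (𝟙 X) ≫ ex := by
          apply coprod.hom_ext <;> simp [binaryComparison]
        apply Limits.prod.hom_ext
        · simp only [Category.assoc, h₁, κ, kernel.condition_assoc, zero_comp, comp_zero]
        · simp only [Category.assoc, h₂, zero_comp]
          simpa using comp_eq_assoc ht ex
      refine ⟨pullback.lift (kernel.lift _ _ h₀ ≫ g) t ?_, pullback.lift_snd _ _ _⟩
      rw [Category.assoc, hg, kernel.lift_ι_assoc, hd]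
      simp
  refine ⟨kernel.lift _ t ht ≫ inv (pullback.snd (imageSubobject x).arrow (κ ≫ coprod.desc w x)) ≫
    pullback.fst _ _, ?_⟩
  simp [pullback.condition, κ]

/-- For the zero weight, the map to `D` factors through the projection of the product onto `K`, so
it kills the co-smash product. -/
lemma wNormal_zero {W D : C} (K : Subobject D) : WNormal (0 : W ⟶ D) K := by
  refine (higgins_le_iff _ _ _).2 ⟨kernel.ι _ ≫ binaryComparison _ _ ≫ prod.snd, ?_⟩
  rw [Category.assoc]
  congr 1
  apply coprod.hom_ext <;> simp [binaryComparison]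

/-- The image of the kernel part of a morphism of points is normal with respect to the section. -/
lemma wNormal_of_point {B : C} {P R : Point B} (α : P ⟶ R) :
    WNormal R.σ (imageSubobject (kernel.ι P.π ≫ α.hom)) := by
  let x := kernel.ι P.π ≫ α.hom
  let J := imageSubobject α.hom
  let e := factorThruImageSubobject α.hom
  have he : e ≫ J.arrow = α.hom := imageSubobject_arrow_comp _
  have hep : e ≫ J.arrow ≫ R.π = P.π := by rw [comp_eq_assoc he, α.hom_π]
  -- the kernel of `J ⟶ B` maps to the image of `x`
  have hJ : ∀ {Z : C} (t : Z ⟶ (J : C)), t ≫ J.arrow ≫ R.π = 0 →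
      ∃ g, g ≫ (imageSubobject x).arrow = t ≫ J.arrow := by
    intro Z t ht
    have hz : pullback.fst e t ≫ P.π = 0 := by
      rw [← hep, ← Category.assoc, pullback.condition, Category.assoc, ht, comp_zero]
    -- `pullback.snd e t` is a regular epimorphism, being a pullback of `e`; orthogonality to the
    -- mono gives the factorization.
    have sq : CommSq (kernel.lift _ _ hz ≫ factorThruImageSubobject x) (pullback.snd e t)
        (imageSubobject x).arrow (t ≫ J.arrow) := ⟨by
      rw [Category.assoc, imageSubobject_arrow_comp, kernel.lift_ι_assoc, ← Category.assoc,
        ← pullback.condition, Category.assoc, he]⟩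
    exact ⟨sq.lift, sq.fac_right⟩
  refine (higgins_le_iff _ _ _).2 ?_
  have h₁ : imageSubobject R.σ ≤ J :=
    imageSubobject_le _ (P.σ ≫ e) (by rw [Category.assoc, he, α.σ_hom])
  have h₂ : imageSubobject x ≤ J :=
    imageSubobject_le _ (kernel.ι P.π ≫ e) (by rw [Category.assoc, he])
  have hx : (imageSubobject x).arrow ≫ R.π = 0 := by
    rw [← cancel_epi (factorThruImageSubobject x), imageSubobject_arrow_comp_assoc]
    simp [x]
  have hd : coprod.desc (Subobject.ofLE _ _ h₁) (Subobject.ofLE _ _ h₂) ≫ J.arrow =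
      coprod.desc (imageSubobject R.σ).arrow (imageSubobject x).arrow := by
    apply coprod.hom_ext <;> simp
  obtain ⟨g, hg⟩ := hJ (kernel.ι (binaryComparison _ _) ≫
    coprod.desc (Subobject.ofLE _ _ h₁) (Subobject.ofLE _ _ h₂)) (by
      rw [Category.assoc, comp_eq_assoc hd]
      have : coprod.desc (imageSubobject R.σ).arrow (imageSubobject x).arrow ≫ R.π =
          binaryComparison _ _ ≫ prod.fst ≫ (imageSubobject R.σ).arrow ≫ R.π := by
        apply coprod.hom_ext <;> simp [binaryComparison, hx]
      rw [this, kernel.condition_assoc, zero_comp])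
  exact ⟨g, by rw [hg, Category.assoc, hd]⟩

/-! ### Higgins commutators and commutation -/

lemma imageSubobject_eq_bot_iff {X D : C} (f : X ⟶ D) : imageSubobject f = ⊥ ↔ f = 0 := by
  constructor
  · intro h
    have hf : (imageSubobject f).arrow = 0 := by rw [h, Subobject.bot_arrow]
    rw [← imageSubobject_arrow_comp f, hf, comp_zero]
  · rintro rfl
    exact imageSubobject_zero

lemma imageSubobject_arrow_eq {D : C} (K : Subobject D) : imageSubobject K.arrow = K := by
  rw [imageSubobject_mono, Subobject.mk_arrow]

instance (X Y : C) : IsRegularEpi (binaryComparison X Y) := by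
  apply isRegularEpi_of_forall_mono
  intro Z p i hp _
  exact (ofProd X Y).isIso_of_mono i ⟨coprod.inl ≫ p, by simp [hp, binaryComparison]⟩
    ⟨coprod.inr ≫ p, by simp [hp, binaryComparison]⟩

/-- A witness of Huq-commutation is a factorization of `[x, y]` through the comparison `X ⨿ Y ⟶ X ⨯
Y`, which is a regular epimorphism. -/
lemma huqCommute_iff {X Y D : C} (x : X ⟶ D) (y : Y ⟶ D) :
    HuqCommute x y ↔ kernel.ι (binaryComparison X Y) ≫ coprod.desc x y = 0 := by
  rw [← exists_fac_iff]
  refine exists_congr fun φ => ⟨fun h => ?_, fun h => ⟨?_, ?_⟩⟩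
  · apply coprod.hom_ext <;> simp [binaryComparison, h.1, h.2]
  · simpa [binaryComparison] using coprod.inl ≫= h
  · simpa [binaryComparison] using coprod.inr ≫= h

lemma higgins_eq_bot_iff {D : C} (K L : Subobject D) :
    higgins K L = ⊥ ↔ HuqCommute K.arrow L.arrow := by
  rw [huqCommute_iff, higgins, imageSubobject_eq_bot_iff]

/-- Commutation over a weight amounts to the vanishing of a binary and a ternary co-smash
product. -/
lemma commuteOver_iff {X Y W D : C} (x : X ⟶ D) (y : Y ⟶ D) (w : W ⟶ D) :
    CommuteOver x y w ↔ HuqCommute x y ∧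
      kernel.ι (ternaryComparison X Y W) ≫ coprod.desc (coprod.desc x y) w = 0 := by
  let T := ofPullback (coprodPoint W X) (coprodPoint W Y)
  have hT : coprod.inl ≫ T.inl = coprod.inl ≫ T.inr := T.σ_inl
  -- The fibre product is a quotient of the triple coproduct, and commuting over `w` means that `[x,
  -- y, w]` descends along `q`.
  let q : (X ⨿ Y) ⨿ W ⟶ T.obj :=
    coprod.desc (coprod.desc (coprod.inr ≫ T.inl) (coprod.inr ≫ T.inr)) (coprod.inl ≫ T.inl)
  let d := coprod.desc (coprod.desc x y) w
  have : IsRegularEpi q := by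
    apply isRegularEpi_of_forall_mono
    intro Z p i hp _
    refine T.isIso_of_mono i ⟨coprod.desc (coprod.inr ≫ p)
      ((coprod.inl ≫ coprod.inl : X ⟶ (X ⨿ Y) ⨿ W) ≫ p), ?_⟩
      ⟨coprod.desc (coprod.inr ≫ p)
      ((coprod.inr ≫ coprod.inl : Y ⟶ (X ⨿ Y) ⨿ W) ≫ p), ?_⟩
    · apply coprod.hom_ext <;> simp [hp, q]
    · apply coprod.hom_ext <;> simp [hp, q, hT]
  have h₁ : CommuteOver x y w ↔ ∃ φ, q ≫ φ = d := by
    refine exists_congr fun φ => ⟨fun h => ?_, fun h => ⟨?_, ?_⟩⟩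
    · have hl : T.inl ≫ φ = coprod.desc w x := h.1
      have hr : T.inr ≫ φ = coprod.desc w y := h.2
      apply coprod.hom_ext
      · apply coprod.hom_ext <;> simp [q, d, hl, hr]
      · simp [q, d, hl]
    · change T.inl ≫ φ = coprod.desc w x
      apply coprod.hom_ext
      · simpa [q, d] using coprod.inr ≫= h
      · simpa [q, d] using coprod.inl ≫= coprod.inl ≫= h
    · change T.inr ≫ φ = coprod.desc w y
      apply coprod.hom_ext
      · simpa [q, d, comp_eq_assoc hT] using coprod.inr ≫= h
      · simpa [q, d] using coprod.inr ≫= coprod.inl ≫= h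
  rw [h₁, exists_fac_iff, huqCommute_iff]
  have hq₁ : q ≫ T.fst = coprod.desc (coprod.desc coprod.inr 0) coprod.inl := by
    apply coprod.hom_ext
    · apply coprod.hom_ext <;> simp [q, coprodPoint]
    · simp [q]
  have hq₂ : q ≫ T.snd = coprod.desc (coprod.desc 0 coprod.inr) coprod.inl := by
    apply coprod.hom_ext
    · apply coprod.hom_ext <;> simp [q, coprodPoint]
    · simp [q, coprodPoint]
  have hρ₁ : coprod.desc (𝟙 (X ⨿ Y)) (0 : W ⟶ _) ≫ binaryComparison X Y ≫ prod.fst =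
      q ≫ T.fst ≫ coprod.desc 0 (𝟙 X) := by
    rw [comp_eq_assoc hq₁]
    apply coprod.hom_ext
    · apply coprod.hom_ext <;> simp [binaryComparison]
    · simp
  have hρ₂ : coprod.desc (𝟙 (X ⨿ Y)) (0 : W ⟶ _) ≫ binaryComparison X Y ≫ prod.snd =
      q ≫ T.snd ≫ coprod.desc 0 (𝟙 Y) := by
    rw [comp_eq_assoc hq₂]
    apply coprod.hom_ext
    · apply coprod.hom_ext <;> simp [binaryComparison]
    · simp
  have hi₁ : coprod.inl ≫ q ≫ T.fst = binaryComparison X Y ≫ prod.fst ≫ coprod.inr := by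
    rw [hq₁]
    apply coprod.hom_ext <;> simp [binaryComparison]
  have hi₂ : coprod.inl ≫ q ≫ T.snd = binaryComparison X Y ≫ prod.snd ≫ coprod.inr := by
    rw [hq₂]
    apply coprod.hom_ext <;> simp [binaryComparison]
  have ht₁ : ternaryComparison X Y W ≫ prod.fst ≫ prod.fst = coprod.desc (𝟙 _) 0 := by
    apply coprod.hom_ext
    · apply coprod.hom_ext <;> simp [ternaryComparison]
    · simp [ternaryComparison]
  have ht₂ : ternaryComparison X Y W ≫ prod.fst ≫ prod.snd =
      q ≫ T.fst ≫ coprod.desc coprod.inr coprod.inl := by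
    rw [comp_eq_assoc hq₁]
    apply coprod.hom_ext
    · apply coprod.hom_ext <;> simp [ternaryComparison]
    · simp [ternaryComparison]
  have ht₃ : ternaryComparison X Y W ≫ prod.snd =
      q ≫ T.snd ≫ coprod.desc coprod.inr coprod.inl := by
    rw [comp_eq_assoc hq₂]
    apply coprod.hom_ext
    · apply coprod.hom_ext <;> simp [ternaryComparison]
    · simp [ternaryComparison]
  have ht₂' : q ≫ T.fst = ternaryComparison X Y W ≫ prod.fst ≫ prod.snd ≫
      coprod.desc coprod.inr coprod.inl := by
    rw [hq₁]
    apply coprod.hom_ext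
    · apply coprod.hom_ext <;> simp [ternaryComparison]
    · simp [ternaryComparison]
  have ht₃' : q ≫ T.snd = ternaryComparison X Y W ≫ prod.snd ≫
      coprod.desc coprod.inr coprod.inl := by
    rw [hq₂]
    apply coprod.hom_ext
    · apply coprod.hom_ext <;> simp [ternaryComparison]
    · simp [ternaryComparison]
  -- Killing `W` sends the kernel of `q` to the binary co-smash product, with section `r` induced by
  -- the inclusion of `X ⨿ Y`. The kernel of `f` is the ternary co-smash product, so vanishing on
  -- the kernel of `q` is vanishing on these two parts.
  let f : kernel q ⟶ kernel (binaryComparison X Y) :=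
    kernel.lift _ (kernel.ι q ≫ coprod.desc (𝟙 (X ⨿ Y)) (0 : W ⟶ _)) (by
      apply Limits.prod.hom_ext
      · simp only [Category.assoc, hρ₁, kernel.condition_assoc, zero_comp]
      · simp only [Category.assoc, hρ₂, kernel.condition_assoc, zero_comp])
  have hf : f ≫ kernel.ι _ = kernel.ι q ≫ coprod.desc (𝟙 (X ⨿ Y)) 0 := kernel.lift_ι _ _ _
  let r : kernel (binaryComparison X Y) ⟶ kernel q :=
    kernel.lift _ (kernel.ι _ ≫ coprod.inl) (by
      apply T.isPullback.hom_ext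
      · simp only [Category.assoc, hi₁, kernel.condition_assoc, zero_comp]
      · simp only [Category.assoc, hi₂, kernel.condition_assoc, zero_comp])
  have hr : r ≫ kernel.ι q = kernel.ι _ ≫ coprod.inl := kernel.lift_ι _ _ _
  constructor
  · intro h
    refine ⟨?_, ?_⟩
    · have := comp_eq_assoc hr d
      rw [h, comp_zero] at this
      simpa [d] using this.symm
    · have hz : kernel.ι (ternaryComparison X Y W) ≫ q = 0 := by
        apply T.isPullback.hom_ext
        · rw [Category.assoc, ht₂', kernel.condition_assoc, zero_comp, zero_comp]
        · rw [Category.assoc, ht₃', kernel.condition_assoc, zero_comp, zero_comp]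
      rw [← kernel.lift_ι q _ hz, Category.assoc, h, comp_zero]
  · rintro ⟨h₂, h₃⟩
    refine hom_ext_of_section_of_kernel (f := f) (r := r) ?_ ?_ fun Z t ht => ?_
    · rw [← cancel_mono (kernel.ι _), Category.assoc, hf, comp_eq_assoc hr]
      simp
    · rw [comp_eq_assoc hr, Category.assoc, comp_zero]
      simpa [d] using h₂
    · have hz : (t ≫ kernel.ι q) ≫ ternaryComparison X Y W = 0 := by
        apply Limits.prod.hom_ext
        · apply Limits.prod.hom_ext
          · simp only [Category.assoc, ht₁, zero_comp]
            rw [← hf, comp_eq_assoc ht, zero_comp]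
          · simp only [Category.assoc, ht₂, kernel.condition_assoc, zero_comp, comp_zero]
        · simp only [Category.assoc, ht₃, kernel.condition_assoc, zero_comp, comp_zero]
      rw [← Category.assoc, ← kernel.lift_ι _ _ hz, Category.assoc, h₃, comp_zero, comp_zero]

/-- Commutation over a weight is inherited along precomposition. -/
lemma CommuteOver.precomp {X Y W D X' Y' W' : C} {x : X ⟶ D} {y : Y ⟶ D} {w : W ⟶ D}
    (h : CommuteOver x y w) (a : X' ⟶ X) (b : Y' ⟶ Y) (c : W' ⟶ W) :
    CommuteOver (a ≫ x) (b ≫ y) (c ≫ w) := by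
  obtain ⟨φ, h₁, h₂⟩ := h
  have hπ {Z Z' : C} (z : Z' ⟶ Z) :
      coprod.map c z ≫ (coprodPoint W Z).π = (coprodPoint W' Z').π ≫ c := by
    apply coprod.hom_ext <;> simp [coprodPoint]
  let ψ : pullback (coprodPoint W' X').π (coprodPoint W' Y').π ⟶
      pullback (coprodPoint W X).π (coprodPoint W Y).π :=
    pullback.lift (pullback.fst _ _ ≫ coprod.map c a) (pullback.snd _ _ ≫ coprod.map c b) (by
      rw [Category.assoc, Category.assoc, hπ, hπ, ← Category.assoc, pullback.condition,
        Category.assoc])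
  refine ⟨ψ ≫ φ, ?_, ?_⟩
  · have : pullback.lift (𝟙 _) ((coprodPoint W' X').π ≫ (coprodPoint W' Y').σ) (by simp) ≫ ψ =
        coprod.map c a ≫ (ofPullback (coprodPoint W X) (coprodPoint W Y)).inl := by
      apply pullback.hom_ext
      · simp [ψ]
      · simp [ψ]
    rw [comp_eq_assoc this, Category.assoc]
    refine (congrArg _ h₁).trans ?_
    apply coprod.hom_ext <;> simp
  · have : pullback.lift ((coprodPoint W' Y').π ≫ (coprodPoint W' X').σ) (𝟙 _) (by simp) ≫ ψ =
        coprod.map c b ≫ (ofPullback (coprodPoint W X) (coprodPoint W Y)).inr := by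
      apply pullback.hom_ext
      · simp [ψ]
      · simp [ψ]
    rw [comp_eq_assoc this, Category.assoc]
    refine (congrArg _ h₂).trans ?_
    apply coprod.hom_ext <;> simp

/-! ### The implications -/

lemma commuteOver_of_ssh (hS : SSH C) {X Y W D : C} {x : X ⟶ D} {y : Y ⟶ D} {w : W ⟶ D}
    (hp : WProper x y w) (h : HuqCommute x y) : CommuteOver x y w := by
  obtain ⟨θ, hθ₁, hθ₂⟩ := h.image
  -- The section `⟨1, w⟩` is what makes `⟨[1, 0], [w, x]⟩` a morphism of points; projecting to `D`
  -- at the end recovers `[w, x]`.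
  let R : Point W := ⟨W ⨯ D, prod.fst, prod.lift (𝟙 W) w, by simp⟩
  let a {Z : C} (z : Z ⟶ D) : coprodPoint W Z ⟶ R :=
    (⟨prod.lift (coprodPoint W Z).π (coprod.desc w z), by simp [R], by
      apply Limits.prod.hom_ext <;> simp [coprodPoint, R]⟩ : Point.Hom _ _)
  let p : (0 : C) ⟶ W := 0
  have hz {Z : C} : pullback.fst (coprodPoint W Z).π p ≫ (coprodPoint W Z).π = 0 := by
    rw [pullback.condition]
    simp [p]
  obtain ⟨g₁, hg₁⟩ := hp.1.exists_fac _ (hz (Z := X))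
  obtain ⟨g₂, hg₂⟩ := hp.2.exists_fac _ (hz (Z := Y))
  have hpa : HuqCommute ((Point.baseChange p).map (a x)) ((Point.baseChange p).map (a y)) := by
    rw [huqCommute_point_iff]
    let P := (Point.baseChange p).obj (coprodPoint W X)
    let Q := (Point.baseChange p).obj (coprodPoint W Y)
    have hP : P.π = 0 := (isZero_zero C).eq_of_tgt _ _
    have hQ : Q.π = 0 := (isZero_zero C).eq_of_tgt _ _
    let T := ofPullback P Q
    -- Over the zero object commutation is plain: `g₁` and `g₂` take values in the images, where `θ`
    -- is defined.
    let ψ : T.obj ⟶ D := prod.lift (T.fst ≫ g₁) (T.snd ≫ g₂) ≫ θ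
    let χ : T.obj ⟶ pullback R.π p := pullback.lift (prod.lift 0 ψ) 0 (by simp [R])
    have hl : T.inl ≫ prod.lift (T.fst ≫ g₁) (T.snd ≫ g₂) = g₁ ≫ prod.lift (𝟙 _) 0 := by
      apply Limits.prod.hom_ext
      · simp
      · simp [hP]
    have hr : T.inr ≫ prod.lift (T.fst ≫ g₁) (T.snd ≫ g₂) = g₂ ≫ prod.lift 0 (𝟙 _) := by
      apply Limits.prod.hom_ext
      · simp [hQ]
      · simp
    refine ⟨χ, ?_, ?_⟩
    · change T.inl ≫ χ = pullback.lift (pullback.fst _ _ ≫ (a x).hom) (pullback.snd _ _) _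
      apply pullback.hom_ext
      · apply Limits.prod.hom_ext
        · simp [χ, a, hz]
        · simpa [χ, a, ψ, comp_eq_assoc hl, -prod.comp_lift, hθ₁] using hg₁
      · exact (isZero_zero C).eq_of_tgt _ _
    · change T.inr ≫ χ = pullback.lift (pullback.fst _ _ ≫ (a y).hom) (pullback.snd _ _) _
      apply pullback.hom_ext
      · apply Limits.prod.hom_ext
        · simp [χ, a, hz]
        · simpa [χ, a, ψ, comp_eq_assoc hr, -prod.comp_lift, hθ₂] using hg₂
      · exact (isZero_zero C).eq_of_tgt _ _
  obtain ⟨φ, h₁, h₂⟩ := (huqCommute_point_iff _ _).1 (hS p (a x) (a y) hpa)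
  refine ⟨φ ≫ prod.snd, ?_, ?_⟩
  · rw [comp_eq_assoc h₁]
    simp [a]
  · rw [comp_eq_assoc h₂]
    simp [a]

/-- If the base changes of two morphisms of points commute, then so do the restrictions of these
morphisms to the kernels. -/
lemma huqCommute_kernel_of_baseChange {E B : C} (p : E ⟶ B) {P Q R : Point B} (α : P ⟶ R)
    (γ : Q ⟶ R) (h : HuqCommute ((Point.baseChange p).map α) ((Point.baseChange p).map γ)) :
    HuqCommute (kernel.ι P.π ≫ α.hom) (kernel.ι Q.π ≫ γ.hom) := by
  obtain ⟨φ, h₁, h₂⟩ := (huqCommute_point_iff _ _).1 h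
  let T := ofPullback ((Point.baseChange p).obj P) ((Point.baseChange p).obj Q)
  -- Base change preserves kernels: the kernel of `P.π` also sits in the pullback, over zero in `E`.
  let k (P : Point B) : kernel P.π ⟶ pullback P.π p := pullback.lift (kernel.ι P.π) 0 (by simp)
  have hk (P : Point B) : k P ≫ ((Point.baseChange p).obj P).π = 0 := pullback.lift_snd _ _ _
  have hk' {P R : Point B} (α : P ⟶ R) : k P ≫ ((Point.baseChange p).map α).hom ≫
      pullback.fst R.π p = kernel.ι P.π ≫ α.hom := by
    simp [k, Point.baseChange]
  let ψ : kernel P.π ⨯ kernel Q.π ⟶ T.obj :=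
    T.isPullback.lift (prod.fst ≫ k P) (prod.snd ≫ k Q)
      (by rw [Category.assoc, Category.assoc, hk, hk, comp_zero, comp_zero])
  have hψ₁ : ψ ≫ T.fst = prod.fst ≫ k P := T.isPullback.lift_fst _ _ _
  have hψ₂ : ψ ≫ T.snd = prod.snd ≫ k Q := T.isPullback.lift_snd _ _ _
  have hl : prod.lift (𝟙 _) 0 ≫ ψ = k P ≫ T.inl := by
    apply T.isPullback.hom_ext
    · rw [Category.assoc, hψ₁, prod.lift_fst_assoc, Category.id_comp, Category.assoc, T.inl_fst]
      exact (Category.comp_id _).symm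
    · rw [Category.assoc, hψ₂, prod.lift_snd_assoc, zero_comp, Category.assoc, T.inl_snd,
        comp_eq_assoc (hk P), zero_comp]
  have hr : prod.lift 0 (𝟙 _) ≫ ψ = k Q ≫ T.inr := by
    apply T.isPullback.hom_ext
    · rw [Category.assoc, hψ₁, prod.lift_fst_assoc, zero_comp, Category.assoc, T.inr_fst,
        comp_eq_assoc (hk Q), zero_comp]
    · rw [Category.assoc, hψ₂, prod.lift_snd_assoc, Category.id_comp, Category.assoc, T.inr_snd]
      exact (Category.comp_id _).symm
  refine ⟨ψ ≫ φ ≫ pullback.fst R.π p, ?_, ?_⟩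
  · rw [comp_eq_assoc hl, Category.assoc, ← hk' α]
    exact congrArg _ (comp_eq_assoc h₁ _)
  · rw [comp_eq_assoc hr, Category.assoc, ← hk' γ]
    exact congrArg _ (comp_eq_assoc h₂ _)

/-- The restrictions of `α` and `γ` to the kernels are proper for the weight `R.σ`, so the
hypothesis applies to them. -/
lemma ssh_of_commuteOver
    (h : ∀ {X Y W D : C} (x : X ⟶ D) (y : Y ⟶ D) (w : W ⟶ D), WProper x y w →
      HuqCommute x y → CommuteOver x y w) : SSH C := by
  intro E B p P Q R α γ hpa
  rw [huqCommute_point_iff]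
  apply admissible_of_commuteOver P Q _ _ (by simp)
  rw [α.σ_hom]
  exact h _ _ _ ⟨wNormal_of_point α, wNormal_of_point γ⟩
    (huqCommute_kernel_of_baseChange p α γ hpa)

end SemiAb

open SemiAb in
theorem theorem3p8 (C : Type u) [Category.{v} C] [HasZeroMorphisms C] [SemiAbelian C] :
    List.TFAE [
      SSH C,
      ∀ {X Y W D : C} (x : X ⟶ D) (y : Y ⟶ D) (w : W ⟶ D), WProper x y w →
        HuqCommute x y → CommuteOver x y w,
      ∀ {X Y D : C} (x : X ⟶ D) (y : Y ⟶ D) {W W' : C} (w : W ⟶ D) (w' : W' ⟶ D),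
        WProper x y w → WProper x y w' → (CommuteOver x y w ↔ CommuteOver x y w'),
      ∀ {X Y W D : C} (x : X ⟶ D) (y : Y ⟶ D) (w : W ⟶ D), WProper x y w →
        higgins (imageSubobject x) (imageSubobject y) = ⊥ →
        higgins₃ (imageSubobject x) (imageSubobject y) (imageSubobject w) = ⊥] := by
  tfae_have 1 → 2 := fun hS _ _ _ _ x y w hp h => commuteOver_of_ssh hS hp h
  tfae_have 2 → 1 := fun h => ssh_of_commuteOver h
  tfae_have 2 → 3 := fun h _ _ _ x y _ _ w w' hp hp' =>
    ⟨fun hc => h x y w' hp' hc.huqCommute, fun hc => h x y w hp hc.huqCommute⟩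
  -- The second weight is `0 ⟶ D`, for which every cospan is proper.
  tfae_have 3 → 2 := fun h _ _ _ _ x y w hp hc =>
    (h x y w _ hp ⟨wNormal_zero _, wNormal_zero _⟩).2 hc.commuteOver_zero
  tfae_have 2 → 4 := by
    intro h X Y W D x y w hp hb
    rw [higgins_eq_bot_iff] at hb
    rw [higgins₃, imageSubobject_eq_bot_iff]
    refine ((commuteOver_iff _ _ _).1 (h _ _ (imageSubobject w).arrow ?_ hb)).2
    simpa only [WProper, WNormal, imageSubobject_arrow_eq] using hp
  -- Commutation is obtained for the images, then restricted along the image factorizations.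
  tfae_have 4 → 2 := by
    intro h X Y W D x y w hp hc
    have hb := h x y w hp ((higgins_eq_bot_iff _ _).2 hc.image)
    rw [higgins₃, imageSubobject_eq_bot_iff] at hb
    have := ((commuteOver_iff _ _ _).2 ⟨hc.image, hb⟩).precomp (factorThruImageSubobject x)
      (factorThruImageSubobject y) (factorThruImageSubobject w)
    simpa only [imageSubobject_arrow_comp] using this
  tfae_finish
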